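/- Let $w_H(x)=e^{-x^2}$ and let $(h_l)_{l\ge 0}$ be the orthonormal Hermite polynomials, i.e. the polynomials of degree $l$ with positive leading coefficient that are orthonormal in $L^2(\mathbb R,w_H)$. For $0\le m\le n$ put $$\Pi_n^m=\Big\{\sum_{l=m}^n c_l h_l:\ c_m,\dots,c_n\in\mathbb C\Big\},\qquad \mathbb S_n^m=\Big\{P\in\Pi_n^m:\ \int_{\mathbb R}|P(x)|^2e^{-x^2}\,dx=1\Big\},$$ $\Pi_n=\Pi_n^0$, $\mathbb S_n=\mathbb S_n^0$, and $\operatorname{var}_S(P)=\int_{\mathbb R}x^2|P(x)|^2e^{-x^2}\,dx$. Let $p_l=p_l^{(-1/2)}$ be the orthonormal Laguerre polynomials for $\alpha=-\tfrac12$, i.e. the polynomials of degree $l$ with positive leading coefficient that are orthonormal in $L^2([0,\infty),x^{-1/2}e^{-x})$, with three-term recurrence $$b_{l+1}p_{l+1}(x)=(x-a_l)p_l(x)-b_lp_{l-1}(x),\quad p_{-1}=0,\qquad a_l=\langle xp_l,p_l\rangle,\ \ b_{l+1}=\langle xp_l,p_{l+1}\rangle>0 .$$ For $k\in\mathbb N_0$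 the associated Laguerre polynomials $p_l(x,k)=p_l^{(-1/2)}(x,k)$ are defined by $$b_{k+l+1}\,p_{l+1}(x,k)=(x-a_{k+l})\,p_l(x,k)-b_{k+l}\,p_{l-1}(x,k)\quad(l\ge 0),\qquad p_{-1}(x,k)=0,\ p_0(x,k)=1 .$$ **Theorem.** Let $0\le m\le n$ be even integers. The polynomials $p_{n/2+1}(x)$ and $p_{(n-m)/2+1}(x,\tfrac m2)$ have smallest real zeros, denoted $\lambda_{n/2+1}$ and $\lambda^{m/2}_{(n-m)/2+1}$. The problems of minimizing $\operatorname{var}_S$ over $\mathbb S_n$ and over $\mathbb S_n^m$ are solved by $$\mathcal H_n(x)=\kappa_1\sum_{l=0}^{n/2}p_l(\lambda_{n/2+1})\,h_{2l}(x),\qquad \mathcal H_n^m(x)=\kappa_2\sum_{l=m/2}^{n/2}p_{l-m/2}\big(\lambda^{m/2}_{(n-m)/2+1},\tfrac m2\big)\,h_{2l}(x),$$ respectively, where the constants $\kappa_1,\kappa_2\in\mathbb C$ are chosen such that $\mathcal H_n\in\mathbb S_n$ and $\mathcal H_n^m\in\mathbb S_n^m$. The minimizers are unique up to multiplication with a complex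 scalar of absolute value one, and the minimal values are $$\min_{P\in\mathbb S_n}\operatorname{var}_S(P)=\lambda_{n/2+1},\qquad \min_{P\in\mathbb S_n^m}\operatorname{var}_S(P)=\lambda^{m/2}_{(n-m)/2+1}.$$ -/

import Mathlib

open Polynomial

noncomputable section

/-- The inner product `∫_s p(x) q(x) w(x) dx` of two real polynomials. -/
def weightedInner (s : Set ℝ) (w : ℝ → ℝ) (p q : ℝ[X]) : ℝ :=
  ∫ x in s, p.eval x * q.eval x * w x

/-- The monic orthogonal polynomials for the weight `w` on `s`, obtained from the monomials
`1, x, x², …` by Gram–Schmidt orthogonalization. -/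
def monicOrthoPoly (s : Set ℝ) (w : ℝ → ℝ) (l : ℕ) : ℝ[X] :=
  X ^ l - ∑ k : Fin l,
    C (weightedInner s w (X ^ l) (monicOrthoPoly s w k) /
      weightedInner s w (monicOrthoPoly s w k) (monicOrthoPoly s w k)) * monicOrthoPoly s w k
termination_by l
decreasing_by all_goals exact k.2

/-- The orthonormal polynomials (with positive leading coefficient) for the weight `w` on `s`. -/
def orthonormalPoly (s : Set ℝ) (w : ℝ → ℝ) (l : ℕ) : ℝ[X] :=
  C (1 / √(weightedInner s w (monicOrthoPoly s w l) (monicOrthoPoly s w l))) *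
    monicOrthoPoly s w l

/-- The coefficient `a_l = ⟨x p_l, p_l⟩` of the three-term recurrence
`b_{l+1} p_{l+1} = (x - a_l) p_l - b_l p_{l-1}` of the orthonormal polynomials. -/
def recurrenceA (s : Set ℝ) (w : ℝ → ℝ) (l : ℕ) : ℝ :=
  weightedInner s w (X * orthonormalPoly s w l) (orthonormalPoly s w l)

/-- The coefficient `b_l = ⟨x p_{l-1}, p_l⟩` (for `l ≥ 1`) of the same recurrence;
`b_0 = 1 / p_0` is the square root of the total mass of the weight. -/
def recurrenceB (s : Set ℝ) (w : ℝ → ℝ) : ℕ → ℝ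
  | 0 => √(weightedInner s w 1 1)
  | l + 1 => weightedInner s w (X * orthonormalPoly s w l) (orthonormalPoly s w (l + 1))

/-- The associated polynomials `p_l(x, m)`: solutions of the recurrence shifted by `m`,
`b_{m+l+1} p_{l+1}(x,m) = (x - a_{m+l}) p_l(x,m) - b_{m+l} p_{l-1}(x,m)`, with
`p_{-1}(x,m) = 0` and `p_0(x,m) = 1`. -/
def associatedPoly (s : Set ℝ) (w : ℝ → ℝ) (m : ℕ) : ℕ → ℝ[X]
  | 0 => 1
  | 1 => C (1 / recurrenceB s w (m + 1)) * (X - C (recurrenceA s w m))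
  | l + 2 => C (1 / recurrenceB s w (m + (l + 1) + 1)) *
      ((X - C (recurrenceA s w (m + (l + 1)))) * associatedPoly s w m (l + 1) -
        C (recurrenceB s w (m + (l + 1))) * associatedPoly s w m l)

/-- The weight `e^{-x²}` on the real line. -/
def hermiteWeight (x : ℝ) : ℝ := Real.exp (-x ^ 2)

/-- The weight `x^α e^{-x}` on `[0, ∞)`. -/
def laguerreWeight (α : ℝ) (x : ℝ) : ℝ := x ^ α * Real.exp (-x)

/-- The orthonormal Hermite polynomials `h_l`. -/
def hermitePoly (l : ℕ) : ℝ[X] := orthonormalPoly Set.univ hermiteWeight l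

/-- The orthonormal Laguerre polynomials `p_l^{(α)}`. -/
def laguerrePoly (α : ℝ) (l : ℕ) : ℝ[X] := orthonormalPoly (Set.Ici 0) (laguerreWeight α) l

/-- The associated Laguerre polynomials `p_l^{(α)}(x, m)`. -/
def associatedLaguerrePoly (α : ℝ) (m l : ℕ) : ℝ[X] :=
  associatedPoly (Set.Ici 0) (laguerreWeight α) m l

/-- `h_l` as a polynomial with complex coefficients. -/
def hermitePolyC (l : ℕ) : ℂ[X] := (hermitePoly l).map (algebraMap ℝ ℂ)

/-- The space `Π_n^m` of complex linear combinations of `h_m, …, h_n`. -/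
def hermiteSpace (m n : ℕ) : Submodule ℂ ℂ[X] :=
  Submodule.span ℂ (hermitePolyC '' Set.Icc m n)

/-- The norm of a polynomial in `L²(ℝ, e^{-x²})`. -/
def hermiteNorm (P : ℂ[X]) : ℝ := √(∫ x : ℝ, ‖P.eval (x : ℂ)‖ ^ 2 * hermiteWeight x)

/-- The unit sphere of `Π_n^m`. -/
def hermiteSphere (m n : ℕ) : Set ℂ[X] := {P | P ∈ hermiteSpace m n ∧ hermiteNorm P = 1}

/-- The position variance `∫ x² |P(x)|² e^{-x²} dx`. -/
def positionVar (P : ℂ[X]) : ℝ := ∫ x : ℝ, x ^ 2 * ‖P.eval (x : ℂ)‖ ^ 2 * hermiteWeight x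

/-- The set of minimizers of the position variance over `S`. -/
def positionVarArgmin (S : Set ℂ[X]) : Set ℂ[X] := {P | P ∈ S ∧ IsMinOn positionVar S P}

/-- `x` is the smallest real zero of the polynomial `p`. -/
def IsSmallestZero (p : ℝ[X]) (x : ℝ) : Prop := IsLeast {y : ℝ | p.eval y = 0} x

end

/-! ### Jacobi recurrences and their quadratic forms -/

/-! Multiplication by `x²` couples `h_i` only to itself and to `h_{i±2}` (`hermiteInner_X_X`), so
the variance splits into two Jacobi forms, one per parity of the index. Substituting `x²` for the
variable carries the Laguerre weight for `α = -1/2` to the Hermite weight and `p_l` to `h_{2l}`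
(`expand_laguerrePoly`). Hence the Jacobi matrix on the even indices from `2k` on generates exactly
the associated Laguerre polynomials with shift `k`.

No spectral theorem is needed. At the smallest zero `z` of `p_{N+1}` the values `p_0(z), …, p_N(z)`
alternate in sign (`exists_smallest_zero_alternating`). The form minus `z ∑ c_j²` is then a sum of
squares of differences of `c_j / p_j(z)` with positive weights (`jacobiForm_sub`), which gives both
the lower bound and the equality case (`jacobiForm_ge`).

The opposite parity has one index fewer. Padded by a final zero, its form dominates the form of the
right parity on the same coefficients (`hermiteForm_le_succ`), so `z` bounds it as well. Equality
would make the padded vector a multiple of a vector without zero entries, hence zero. Complex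
polynomials reduce to their real and imaginary parts. -/

/-- The polynomials generated by the three-term recurrence with diagonal `a` and off-diagonal `b`. -/
structure IsJacobiSeq (a b : ℕ → ℝ) (p : ℕ → ℝ[X]) : Prop where
  zero : p 0 = 1
  one : C (b 0) * p 1 = (X - C (a 0)) * p 0
  succ : ∀ l, C (b (l + 1)) * p (l + 2) = (X - C (a (l + 1))) * p (l + 1) - C (b l) * p l

/-- The quadratic form of the Jacobi matrix of size `N + 1`. -/
noncomputable def jacobiForm (a b : ℕ → ℝ) (N : ℕ) (c : ℕ → ℝ) : ℝ :=
  ∑ j ∈ Finset.range (N + 1), a j * c j ^ 2 + 2 * ∑ j ∈ Finset.range N, b j * c j * c (j + 1)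

namespace IsJacobiSeq

variable {a b : ℕ → ℝ} {p : ℕ → ℝ[X]}

theorem eval_one (h : IsJacobiSeq a b p) (x : ℝ) : b 0 * (p 1).eval x = x - a 0 := by
  simpa [h.zero] using congrArg (eval x) h.one

theorem eval_succ (h : IsJacobiSeq a b p) (x : ℝ) (l : ℕ) :
    b (l + 1) * (p (l + 2)).eval x = (x - a (l + 1)) * (p (l + 1)).eval x - b l * (p l).eval x := by
  simpa using congrArg (eval x) (h.succ l)

/-- The growth statement in `l` is what carries positivity through the recurrence: once `a_{l+1} - x
≥ b_{l+1} + b_l`, the term in `p_{l+1}` absorbs the one in `p_l`. -/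
theorem tendsto_atBot (h : IsJacobiSeq a b p) (hb : ∀ l, 0 < b l) (l : ℕ) :
    (∀ᶠ x in Filter.atBot, 0 < (-1) ^ l * (p l).eval x) ∧
    (∀ᶠ x in Filter.atBot, (-1) ^ l * (p l).eval x ≤ (-1) ^ (l + 1) * (p (l + 1)).eval x) := by
  induction l with
  | zero =>
    refine ⟨by simp [h.zero], ?_⟩
    filter_upwards [Filter.eventually_le_atBot (a 0 - b 0)] with x hx
    have := h.eval_one x
    have hb0 := hb 0
    simp only [h.zero, pow_zero, zero_add, pow_one]
    by_contra! hlt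
    simp only [Polynomial.eval_one] at hlt
    nlinarith
  | succ l ih =>
    have hpos : ∀ᶠ x in Filter.atBot, 0 < (-1) ^ (l + 1) * (p (l + 1)).eval x := by
      filter_upwards [ih.1, ih.2] with x h1 h2 using h1.trans_le h2
    refine ⟨hpos, ?_⟩
    filter_upwards [hpos, ih.1, ih.2, Filter.eventually_le_atBot (a (l + 1) - b (l + 1) - b l)]
      with x h0 h1 h2 hx
    have hr := h.eval_succ x l
    have hb0 := hb l
    have hb1 := hb (l + 1)
    set e : ℝ := (-1) ^ l
    have e1 : (-1 : ℝ) ^ (l + 1) = - e := by simp [e, pow_succ]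
    have e2 : (-1 : ℝ) ^ (l + 1 + 1) = e := by simp [e, pow_succ]
    rw [e1] at h0 h2 ⊢
    rw [e2]
    have hr' : b (l + 1) * (e * (p (l + 2)).eval x) =
        (a (l + 1) - x) * (-e * (p (l + 1)).eval x) - b l * (e * (p l).eval x) := by
      linear_combination e * hr
    by_contra! hlt
    have h3 : b (l + 1) * (e * (p (l + 2)).eval x) < b (l + 1) * (-e * (p (l + 1)).eval x) :=
      mul_lt_mul_of_pos_left hlt hb1
    nlinarith [mul_le_mul_of_nonneg_left h2 hb0.le]

/-- If `(-1)^l p_l` is nonpositive somewhere, then it has a smallest zero, at most that point, and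
it is positive below that zero. -/
theorem exists_smallest_zero (h : IsJacobiSeq a b p) (hb : ∀ l, 0 < b l) (l : ℕ) {y : ℝ}
    (hy : (-1) ^ l * (p l).eval y ≤ 0) :
    ∃ z ≤ y, IsSmallestZero (p l) z ∧ ∀ t < z, 0 < (-1) ^ l * (p l).eval t := by
  have hcont : Continuous fun x => (-1) ^ l * (p l).eval x := by fun_prop
  have key : ∀ t, (-1) ^ l * (p l).eval t ≤ 0 → ∃ z ≤ t, (p l).eval z = 0 := by
    intro t ht
    obtain ⟨s, hs, hst⟩ := ((h.tendsto_atBot hb l).1.and (Filter.eventually_le_atBot t)).exists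
    obtain ⟨z, hz, hz0⟩ := intermediate_value_Icc' hst hcont.continuousOn ⟨ht, hs.le⟩
    exact ⟨z, hz.2, by simpa using hz0⟩
  have hne : p l ≠ 0 := by
    rintro h0
    obtain ⟨s, hs⟩ := (h.tendsto_atBot hb l).1.exists
    simp [h0] at hs
  have hfin : {y : ℝ | (p l).eval y = 0}.Finite := by
    refine (p l).roots.toFinset.finite_toSet.subset fun z hz => ?_
    simpa [hne] using hz
  obtain ⟨z₀, hz₀, hz₀'⟩ := key y hy
  obtain ⟨z, hz, hmin⟩ := hfin.exists_minimal ⟨z₀, hz₀'⟩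
  have hle : ∀ t, (p l).eval t = 0 → z ≤ t := by
    intro t ht
    rcases le_total z t with h1 | h1
    · exact h1
    · exact hmin ht h1
  refine ⟨z, (hle _ hz₀').trans hz₀, ⟨hz, fun t ht => hle t ht⟩, fun t ht => ?_⟩
  by_contra! hneg
  obtain ⟨s, hs, hs0⟩ := key t hneg
  exact absurd (hle s hs0) (not_le.2 (hs.trans_lt ht))

/-- At a zero of `p_{l+1}` the recurrence makes `p_{l+2}` and `p_l` opposite in sign, so `(-1)^(l+2)
p_{l+2}` is already negative there and its smallest zero lies strictly further left. Signs are
recorded for all `t ≤ z` because the next zero lies in that range. -/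
theorem smallest_zero_aux (h : IsJacobiSeq a b p) (hb : ∀ l, 0 < b l) (l : ℕ) :
    ∃ z, IsSmallestZero (p (l + 1)) z ∧ (∀ t < z, 0 < (-1) ^ (l + 1) * (p (l + 1)).eval t) ∧
      ∀ t ≤ z, ∀ j ≤ l, 0 < (-1) ^ j * (p j).eval t := by
  induction l with
  | zero =>
    obtain ⟨z, -, hz, hpos⟩ := h.exists_smallest_zero hb 1 (y := a 0) (by
      have := h.eval_one (a 0)
      have := hb 0
      simp_all [ne_of_gt])
    refine ⟨z, hz, hpos, fun t _ j hj => ?_⟩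
    obtain rfl : j = 0 := by omega
    simp [h.zero]
  | succ l ih =>
    obtain ⟨z, hz, hpos, hall⟩ := ih
    have hz0 : (p (l + 1)).eval z = 0 := hz.1
    have hneg : (-1) ^ (l + 2) * (p (l + 2)).eval z < 0 := by
      have h1 := h.eval_succ z l
      have h2 := hall z le_rfl l le_rfl
      rw [hz0] at h1
      by_contra! h3
      rw [pow_add] at h3
      have h4 := mul_nonneg (hb (l + 1)).le h3
      have h5 := mul_pos (hb l) h2
      have : b (l + 1) * ((-1) ^ l * (-1) ^ 2 * (p (l + 2)).eval z) =
        - (b l * ((-1) ^ l * (p l).eval z)) := by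
        linear_combination (-1) ^ l * h1
      linarith
    obtain ⟨z', hz'z, hz', hpos'⟩ := h.exists_smallest_zero hb (l + 2) hneg.le
    have hlt : z' < z := by
      refine lt_of_le_of_ne hz'z ?_
      rintro rfl
      have : (p (l + 2)).eval z' = 0 := hz'.1
      simp [this] at hneg
    refine ⟨z', hz', hpos', fun t ht j hj => ?_⟩
    rcases Nat.lt_or_ge l j with h1 | h1
    · obtain rfl : j = l + 1 := by omega
      exact hpos t (ht.trans_lt hlt)
    · exact hall t (ht.trans hlt.le) j h1

/-- At the smallest zero of `p_{N+1}` the polynomials of lower degree alternate in sign. -/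
theorem exists_smallest_zero_alternating (h : IsJacobiSeq a b p) (hb : ∀ l, 0 < b l) (N : ℕ) :
    ∃ z, IsSmallestZero (p (N + 1)) z ∧ ∀ j ≤ N, 0 < (-1) ^ j * (p j).eval z := by
  obtain ⟨z, hz, -, h2⟩ := h.smallest_zero_aux hb N
  exact ⟨z, hz, h2 z le_rfl⟩

/-- Ground state representation of the Jacobi form. -/
theorem jacobiForm_sub (h : IsJacobiSeq a b p) (N : ℕ) (z : ℝ)
    (hne : ∀ j ≤ N, (p j).eval z ≠ 0) (c : ℕ → ℝ) :
    jacobiForm a b N c - z * ∑ j ∈ Finset.range (N + 1), c j ^ 2 =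
      ∑ j ∈ Finset.range N, -(b j * (p j).eval z * (p (j + 1)).eval z) *
        (c j / (p j).eval z - c (j + 1) / (p (j + 1)).eval z) ^ 2 -
      b N * (p (N + 1)).eval z / (p N).eval z * c N ^ 2 := by
  unfold jacobiForm
  induction N with
  | zero =>
    have := h.eval_one z
    simp [h.zero]
    linear_combination c 0 ^ 2 * this
  | succ N ih =>
    have ih := ih fun j hj => hne j (by omega)
    have h0 := hne N (by omega)
    have h1 := hne (N + 1) le_rfl
    have hr := h.eval_succ z N
    rw [Finset.sum_range_succ _ (N + 1), Finset.sum_range_succ (fun j => b j * c j * c (j + 1)) N,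
      Finset.sum_range_succ _ (N + 1), Finset.sum_range_succ (fun j => -(b j * (p j).eval z * (p (j + 1)).eval z) *
        (c j / (p j).eval z - c (j + 1) / (p (j + 1)).eval z) ^ 2) N]
    -- One new index trades the boundary term at `N` for a new square and a boundary term at `N +
    -- 1`; the recurrence at `z` makes the coefficients match.
    have hstep : a (N + 1) * c (N + 1) ^ 2 + 2 * (b N * c N * c (N + 1)) - z * c (N + 1) ^ 2 =
        -(b N * (p N).eval z * (p (N + 1)).eval z) *
          (c N / (p N).eval z - c (N + 1) / (p (N + 1)).eval z) ^ 2 -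
        b (N + 1) * (p (N + 2)).eval z / (p (N + 1)).eval z * c (N + 1) ^ 2 +
        b N * (p (N + 1)).eval z / (p N).eval z * c N ^ 2 := by
      rw [hr]
      field_simp
      ring
    linear_combination ih + hstep

/-- The boundary term of `jacobiForm_sub` vanishes at a zero of `p_{N+1}`, and alternation makes
every weight positive; equality then forces all ratios `c_j / p_j(z)` to agree. -/
theorem jacobiForm_ge (h : IsJacobiSeq a b p) (hb : ∀ l, 0 < b l) {N : ℕ} {z : ℝ}
    (hz : (p (N + 1)).eval z = 0) (halt : ∀ j ≤ N, 0 < (-1) ^ j * (p j).eval z) (c : ℕ → ℝ) :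
    z * ∑ j ∈ Finset.range (N + 1), c j ^ 2 ≤ jacobiForm a b N c ∧
    (jacobiForm a b N c = z * ∑ j ∈ Finset.range (N + 1), c j ^ 2 ↔
      ∃ r : ℝ, ∀ j ≤ N, c j = r * (p j).eval z) := by
  have hne : ∀ j ≤ N, (p j).eval z ≠ 0 := fun j hj h0 => by simpa [h0] using halt j hj
  have hw : ∀ j ∈ Finset.range N, 0 < -(b j * (p j).eval z * (p (j + 1)).eval z) := by
    intro j hj
    rw [Finset.mem_range] at hj
    have h1 := mul_pos (halt j hj.le) (halt (j + 1) hj)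
    have h2 : ((-1 : ℝ) ^ j) ^ 2 = 1 := by rw [← pow_mul, mul_comm, pow_mul]; simp
    have h3 : (-1) ^ j * (p j).eval z * ((-1) ^ (j + 1) * (p (j + 1)).eval z) =
        -((p j).eval z * (p (j + 1)).eval z) := by
      rw [pow_succ]; linear_combination -((p j).eval z * (p (j + 1)).eval z) * h2
    rw [h3] at h1
    nlinarith [hb j]
  have hid := h.jacobiForm_sub N z hne c
  rw [hz] at hid
  simp only [mul_zero, zero_div, zero_mul, sub_zero] at hid
  have hnn : ∀ j ∈ Finset.range N, 0 ≤ -(b j * (p j).eval z * (p (j + 1)).eval z) *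
        (c j / (p j).eval z - c (j + 1) / (p (j + 1)).eval z) ^ 2 :=
    fun j hj => mul_nonneg (hw j hj).le (sq_nonneg _)
  refine ⟨by linarith [Finset.sum_nonneg hnn], ?_⟩
  rw [← sub_eq_zero, hid, Finset.sum_eq_zero_iff_of_nonneg hnn]
  constructor
  · intro h0
    refine ⟨c 0 / (p 0).eval z, fun j => ?_⟩
    induction j with
    | zero => intro hj; rw [div_mul_cancel₀ _ (hne 0 hj)]
    | succ j ih =>
      intro hj
      have h1 := h0 j (Finset.mem_range.2 hj)
      rw [mul_eq_zero, or_iff_right (hw j (Finset.mem_range.2 hj)).ne', sq_eq_zero_iff,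
        sub_eq_zero, ih (by omega), mul_div_cancel_right₀ _ (hne j (by omega)),
        eq_div_iff (hne _ hj)] at h1
      exact h1.symm
  · rintro ⟨r, hr⟩ j hj
    rw [Finset.mem_range] at hj
    rw [hr j hj.le, hr (j + 1) hj, mul_div_cancel_right₀ _ (hne _ hj.le),
      mul_div_cancel_right₀ _ (hne _ hj)]
    simp

end IsJacobiSeq

/-! ### Comparison of the even and the odd Hermite form -/

/-- The matrix element of `x²` between `h_i` and `h_{i+2}`. -/
noncomputable def hermiteOff (i : ℕ) : ℝ := √((i + 1) * (i + 2)) / 2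

theorem hermiteOff_pos (i : ℕ) : 0 < hermiteOff i := by
  unfold hermiteOff; positivity

theorem hermiteOff_eq (l : ℕ) : hermiteOff l = √((l + 1) / 2) * √((l + 2) / 2) := by
  rw [← Real.sqrt_mul (by positivity), hermiteOff,
    show ((l : ℝ) + 1) / 2 * ((l + 2) / 2) = (l + 1) * (l + 2) / 2 ^ 2 by ring,
    Real.sqrt_div (by positivity), Real.sqrt_sq (by norm_num)]

/-- With `s, t, u` the roots of `i+1, i+2, i+3`, the difference equals `t / (u + s)`, and the bound
follows from `s u ≤ t²` and `4 s u ≤ (u + s)²`. The right side is the product of the weights `u`,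
`v` in the induction of `sum_sq_add_hermiteOff_ge`. -/
theorem hermiteOff_succ_sub (i : ℕ) :
    hermiteOff i ≤ hermiteOff (i + 1) ∧
    (hermiteOff (i + 1) - hermiteOff i) ^ 2 ≤
      (i + 2 : ℝ) / (2 * (i + 1)) * ((i + 2 : ℝ) / (2 * (i + 3))) := by
  unfold hermiteOff
  push_cast
  have hA : √(((i : ℝ) + 1) * (i + 2)) = √(i + 1) * √(i + 2) := Real.sqrt_mul (by positivity) _
  have hB : √(((i : ℝ) + 1 + 1) * (i + 1 + 2)) = √(i + 2) * √(i + 3) := by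
    rw [Real.sqrt_mul (by positivity)]; congr 2 <;> ring
  rw [hA, hB]
  set s := √((i : ℝ) + 1)
  set t := √((i : ℝ) + 2)
  set u := √((i : ℝ) + 3)
  have hs : s ^ 2 = i + 1 := Real.sq_sqrt (by positivity)
  have ht : t ^ 2 = i + 2 := Real.sq_sqrt (by positivity)
  have hu : u ^ 2 = i + 3 := Real.sq_sqrt (by positivity)
  have hs0 : 0 < s := Real.sqrt_pos.2 (by positivity)
  have ht0 : 0 < t := Real.sqrt_pos.2 (by positivity)
  have hu0 : 0 < u := Real.sqrt_pos.2 (by positivity)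
  have hsu : s ≤ u := Real.sqrt_le_sqrt (by linarith)
  refine ⟨by nlinarith, ?_⟩
  have e1 : (u - s) * (u + s) = 2 := by nlinarith
  have e2 : u - s = 2 / (u + s) := by field_simp; linarith
  have e3 : t * u / 2 - s * t / 2 = t / (u + s) := by
    have : t * u / 2 - s * t / 2 = t * (u - s) / 2 := by ring
    rw [this, e2]; ring
  rw [e3, ← hs, ← ht, ← hu, div_pow, div_mul_div_comm, div_le_div_iff₀ (by positivity) (by positivity)]
  have k1 : s * u ≤ t ^ 2 := by nlinarith
  have k2 : 4 * (s * u) ≤ (u + s) ^ 2 := by nlinarith [sq_nonneg (u - s)]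
  have k3 : 4 * (s * u) ^ 2 ≤ t ^ 2 * (u + s) ^ 2 := by
    have := mul_le_mul k1 k2 (by positivity) (by positivity)
    nlinarith
  nlinarith [mul_le_mul_of_nonneg_left k3 (sq_nonneg t)]

/-- Nonnegativity alone does not induct, so a share of the last square is kept in reserve. Each step
spends the reserve `u` and the part `v` of the new square on the cross term, as `d² ≤ u v`; what
remains, `1 - v`, is the next reserve. -/
theorem sum_sq_add_hermiteOff_ge (m N : ℕ) (c : ℕ → ℝ) :
    (m + 2 * N + 2 : ℝ) / (2 * (m + 2 * N + 1)) * c N ^ 2 ≤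
      ∑ j ∈ Finset.range (N + 1), c j ^ 2 + 2 * ∑ j ∈ Finset.range N,
        (hermiteOff (m + 2 * j + 1) - hermiteOff (m + 2 * j)) * c j * c (j + 1) := by
  induction N with
  | zero =>
    simp only [Nat.cast_zero, mul_zero, add_zero, zero_add, Finset.sum_range_one,
      Finset.range_zero, Finset.sum_empty]
    refine mul_le_of_le_one_left (sq_nonneg _) ?_
    rw [div_le_one (by positivity)]
    have : (0 : ℝ) ≤ m := by positivity
    linarith
  | succ N ih =>
    rw [Finset.sum_range_succ _ (N + 1), Finset.sum_range_succ
      (fun j => (hermiteOff (m + 2 * j + 1) - hermiteOff (m + 2 * j)) * c j * c (j + 1)) N]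
    obtain ⟨h1, h2⟩ := hermiteOff_succ_sub (m + 2 * N)
    set d := hermiteOff (m + 2 * N + 1) - hermiteOff (m + 2 * N)
    push_cast at h2 ⊢
    set i : ℝ := m + 2 * N
    have hi : 0 ≤ i := by positivity
    have e : (m + 2 * (N + 1 : ℝ)) = i + 2 := by simp only [i]; ring
    rw [e]
    set u := (i + 2) / (2 * (i + 1))
    set v := (i + 2) / (2 * (i + 3))
    have hv : (i + 2 + 2) / (2 * (i + 2 + 1)) = 1 - v := by
      simp only [v]; field_simp; ring
    have hu0 : 0 < u := by positivity
    have hv0 : 0 < v := by positivity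
    rw [hv]
    suffices 0 ≤ u * c N ^ 2 + v * c (N + 1) ^ 2 + 2 * d * c N * c (N + 1) by nlinarith
    have : 0 ≤ u * (u * c N ^ 2 + v * c (N + 1) ^ 2 + 2 * d * c N * c (N + 1)) := by
      have e : u * (u * c N ^ 2 + v * c (N + 1) ^ 2 + 2 * d * c N * c (N + 1)) =
        (u * c N + d * c (N + 1)) ^ 2 + (u * v - d ^ 2) * c (N + 1) ^ 2 := by ring
      rw [e]
      exact add_nonneg (sq_nonneg _) (mul_nonneg (sub_nonneg.2 h2) (sq_nonneg _))
    exact (mul_nonneg_iff_of_pos_left hu0).1 this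

/-- The quadratic form of multiplication by `x²` on the span of `h_m, h_{m+2}, …, h_{m+2N}`. -/
noncomputable def hermiteForm (m : ℕ) : ℕ → (ℕ → ℝ) → ℝ :=
  jacobiForm (fun j => (m + 2 * j : ℕ) + 1 / 2) (fun j => hermiteOff (m + 2 * j))

/-- Raising all indices by one adds exactly `1` to each diagonal entry, which outweighs the growth
of the off-diagonal entries. -/
theorem hermiteForm_le_succ (m N : ℕ) (c : ℕ → ℝ) : hermiteForm m N c ≤ hermiteForm (m + 1) N c := by
  have h := sum_sq_add_hermiteOff_ge m N c
  have h0 : 0 ≤ (m + 2 * N + 2 : ℝ) / (2 * (m + 2 * N + 1)) * c N ^ 2 := by positivity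
  have e : hermiteForm (m + 1) N c - hermiteForm m N c =
      ∑ j ∈ Finset.range (N + 1), c j ^ 2 + 2 * ∑ j ∈ Finset.range N,
        (hermiteOff (m + 2 * j + 1) - hermiteOff (m + 2 * j)) * c j * c (j + 1) := by
    unfold hermiteForm jacobiForm
    rw [add_sub_add_comm, ← mul_sub, ← Finset.sum_sub_distrib, ← Finset.sum_sub_distrib]
    congr 1
    · refine Finset.sum_congr rfl fun j _ => ?_
      push_cast; ring
    · congr 1
      refine Finset.sum_congr rfl fun j _ => ?_
      simp only [show m + 1 + 2 * j = m + 2 * j + 1 by ring]; ring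
  linarith

/-! ### The Hermite inner product -/

theorem weightedInner_comm (s : Set ℝ) (w : ℝ → ℝ) (f g : ℝ[X]) :
    weightedInner s w f g = weightedInner s w g f := by
  unfold weightedInner
  simp only [mul_comm (eval _ f)]

/-- The inner product of `L²(ℝ, e^{-x²})` on polynomials. -/
noncomputable abbrev hermiteInner (f g : ℝ[X]) : ℝ := weightedInner Set.univ hermiteWeight f g

theorem integrable_eval_mul_hermiteWeight (f : ℝ[X]) :
    MeasureTheory.Integrable fun x : ℝ => f.eval x * hermiteWeight x := by
  induction f using Polynomial.induction_on' with
  | add f g hf hg =>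
    simp only [eval_add, add_mul]
    exact hf.add hg
  | monomial n r =>
    have h := integrable_rpow_mul_exp_neg_mul_sq one_pos (s := n)
      (lt_of_lt_of_le (by norm_num) (Nat.cast_nonneg n))
    refine (h.const_mul r).congr (Filter.Eventually.of_forall fun x => ?_)
    simp [hermiteWeight, mul_assoc]

theorem integrable_eval_mul_eval (f g : ℝ[X]) :
    MeasureTheory.Integrable fun x : ℝ => f.eval x * g.eval x * hermiteWeight x := by
  simpa using integrable_eval_mul_hermiteWeight (f * g)

theorem hermiteInner_eq (f g : ℝ[X]) :
    hermiteInner f g = ∫ x : ℝ, f.eval x * g.eval x * hermiteWeight x := by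
  simp [hermiteInner, weightedInner]

theorem hermiteInner_add_left (f g r : ℝ[X]) :
    hermiteInner (f + g) r = hermiteInner f r + hermiteInner g r := by
  simp only [hermiteInner_eq, eval_add, add_mul]
  exact MeasureTheory.integral_add (integrable_eval_mul_eval f r) (integrable_eval_mul_eval g r)

theorem hermiteInner_C_mul_left (a : ℝ) (f r : ℝ[X]) :
    hermiteInner (C a * f) r = a * hermiteInner f r := by
  simp only [hermiteInner_eq, eval_mul, eval_C, mul_assoc]
  exact MeasureTheory.integral_const_mul _ _

theorem hermiteInner_comm (f g : ℝ[X]) : hermiteInner f g = hermiteInner g f :=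
  weightedInner_comm _ _ f g

theorem hermiteInner_add_right (f g r : ℝ[X]) :
    hermiteInner f (g + r) = hermiteInner f g + hermiteInner f r := by
  simp only [hermiteInner_comm f]
  exact hermiteInner_add_left g r f

theorem hermiteInner_C_mul_right (a : ℝ) (f r : ℝ[X]) :
    hermiteInner f (C a * r) = a * hermiteInner f r := by
  simp only [hermiteInner_comm f]
  exact hermiteInner_C_mul_left a r f

theorem hermiteInner_X_mul (f g : ℝ[X]) : hermiteInner (X * f) g = hermiteInner f (X * g) := by
  simp only [hermiteInner_eq, eval_mul, eval_X]
  congr 1; ext x; ring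

theorem integral_derivative_mul_hermiteWeight (f : ℝ[X]) :
    ∫ x : ℝ, (derivative f - C 2 * X * f).eval x * hermiteWeight x = 0 := by
  refine MeasureTheory.integral_eq_zero_of_hasDerivAt_of_integrable
    (f := fun x => f.eval x * hermiteWeight x) (fun x => ?_)
    (integrable_eval_mul_hermiteWeight _) (integrable_eval_mul_hermiteWeight f)
  have h1 : HasDerivAt hermiteWeight (Real.exp (-x ^ 2) * (-(2 * x))) x := by
    have := ((hasDerivAt_pow 2 x).neg).exp
    refine this.congr_deriv ?_
    simp
  refine ((f.hasDerivAt x).mul h1).congr_deriv ?_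
  simp only [eval_sub, eval_mul, eval_C, eval_X, hermiteWeight]
  ring

theorem hermiteInner_derivative (f g : ℝ[X]) :
    hermiteInner (derivative f) g + hermiteInner f (derivative g) = 2 * hermiteInner f (X * g) := by
  have h := integral_derivative_mul_hermiteWeight (f * g)
  have e : ∀ x : ℝ, (derivative (f * g) - C 2 * X * (f * g)).eval x * hermiteWeight x =
      ((derivative f).eval x * g.eval x * hermiteWeight x +
        f.eval x * (derivative g).eval x * hermiteWeight x) -
        2 * (f.eval x * (X * g).eval x * hermiteWeight x) := by
    intro x; simp [derivative_mul]; ring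
  simp only [e] at h
  rw [MeasureTheory.integral_sub, MeasureTheory.integral_add, MeasureTheory.integral_const_mul] at h
  · simp only [hermiteInner_eq]; linarith
  · exact integrable_eval_mul_eval _ _
  · exact integrable_eval_mul_eval _ _
  · exact (integrable_eval_mul_eval _ _).add (integrable_eval_mul_eval _ _)
  · exact (integrable_eval_mul_eval _ _).const_mul 2

/-! ### Monic Hermite polynomials -/

/-- The monic Hermite polynomials for the weight `e^{-x²}`. -/
noncomputable def monicHermite : ℕ → ℝ[X]
  | 0 => 1
  | l + 1 => X * monicHermite l - C (1 / 2) * derivative (monicHermite l)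

theorem monicHermite_succ (l : ℕ) : monicHermite (l + 1) =
    X * monicHermite l - C (1 / 2) * derivative (monicHermite l) := rfl

theorem derivative_monicHermite (l : ℕ) :
    derivative (monicHermite (l + 1)) = C (l + 1 : ℝ) * monicHermite l := by
  induction l with
  | zero => simp [monicHermite]
  | succ l ih =>
    rw [monicHermite_succ (l + 1), ih, derivative_sub, derivative_mul, ih, derivative_C_mul,
      derivative_C_mul, monicHermite_succ l]
    simp only [derivative_X, Nat.cast_add, Nat.cast_one, C_add, C_1]
    ring

theorem X_mul_monicHermite (l : ℕ) : X * monicHermite (l + 1) =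
    monicHermite (l + 2) + C ((l + 1) / 2 : ℝ) * monicHermite l := by
  rw [monicHermite_succ (l + 1), derivative_monicHermite, ← mul_assoc, ← C_mul]
  ring_nf

theorem monicHermite_monic (l : ℕ) :
    (monicHermite l).Monic ∧ (monicHermite l).natDegree = l := by
  induction l with
  | zero => simp [monicHermite]
  | succ l ih =>
    have hX : (X * monicHermite l).Monic := monic_X.mul ih.1
    have hd : (X * monicHermite l).natDegree = l + 1 := by
      rw [monic_X.natDegree_mul ih.1, ih.2, natDegree_X, add_comm]
    have hlt : (C (1 / 2) * derivative (monicHermite l)).degree < (X * monicHermite l).degree := by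
      rw [degree_eq_natDegree hX.ne_zero, hd]
      rw [degree_C_mul (by norm_num)]
      refine degree_derivative_le.trans_lt ?_
      rw [degree_eq_natDegree ih.1.ne_zero, ih.2]
      exact_mod_cast Nat.lt_succ_self l
    refine ⟨hX.sub_of_left hlt, ?_⟩
    rw [monicHermite_succ, natDegree_eq_of_degree_eq (degree_sub_eq_left_of_degree_lt hlt), hd]

/-- Integration by parts: the raising operator `x - ½ d/dx` is adjoint to `½ d/dx`. Orthogonality
follows by differentiating the left factor until it vanishes. -/
theorem hermiteInner_monicHermite_succ (f : ℝ[X]) (l : ℕ) :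
    hermiteInner f (monicHermite (l + 1)) = 1 / 2 * hermiteInner (derivative f) (monicHermite l) := by
  have h := hermiteInner_derivative f (monicHermite l)
  have e : monicHermite (l + 1) =
      X * monicHermite l + C (-(1 / 2)) * derivative (monicHermite l) := by
    rw [monicHermite_succ, C_neg]; ring
  rw [e, hermiteInner_add_right, hermiteInner_C_mul_right]
  linarith

theorem hermiteInner_zero_left (f : ℝ[X]) : hermiteInner 0 f = 0 := by
  simp [hermiteInner_eq]

theorem hermiteInner_monicHermite_eq_zero (l : ℕ) :
    ∀ f : ℝ[X], f.degree < l → hermiteInner f (monicHermite l) = 0 := by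
  induction l with
  | zero =>
    intro f hf
    rw [Nat.cast_zero] at hf
    rw [degree_eq_bot.1 (Nat.WithBot.lt_zero_iff.1 hf), hermiteInner_zero_left]
  | succ l ih =>
    intro f hf
    rw [hermiteInner_monicHermite_succ]
    rcases eq_or_ne f 0 with rfl | h0
    · simp [hermiteInner_zero_left]
    · rw [ih _ (lt_of_lt_of_le (degree_derivative_lt h0) ?_), mul_zero]
      rw [degree_eq_natDegree h0] at hf ⊢
      exact_mod_cast Nat.lt_succ_iff.1 (by exact_mod_cast hf)

/-- The squared norm of the monic Hermite polynomial of degree `l`. -/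
noncomputable def hermiteSq (l : ℕ) : ℝ := hermiteInner (monicHermite l) (monicHermite l)

theorem hermiteSq_succ (l : ℕ) : hermiteSq (l + 1) = (l + 1) / 2 * hermiteSq l := by
  rw [hermiteSq, hermiteInner_monicHermite_succ, derivative_monicHermite, hermiteInner_C_mul_left,
    hermiteSq]
  ring

theorem hermiteSq_pos (l : ℕ) : 0 < hermiteSq l := by
  induction l with
  | zero =>
    have : hermiteSq 0 = √(Real.pi / 1) := by
      rw [← integral_gaussian, hermiteSq, hermiteInner_eq]
      simp [monicHermite, hermiteWeight]
    rw [this]; positivity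
  | succ l ih => rw [hermiteSq_succ]; positivity

theorem hermiteInner_monicHermite (i j : ℕ) :
    hermiteInner (monicHermite i) (monicHermite j) = if i = j then hermiteSq i else 0 := by
  have key : ∀ i j, i < j → hermiteInner (monicHermite i) (monicHermite j) = 0 := by
    intro i j hij
    refine hermiteInner_monicHermite_eq_zero j _ ?_
    rw [degree_eq_natDegree (monicHermite_monic i).1.ne_zero, (monicHermite_monic i).2]
    exact_mod_cast hij
  rcases lt_trichotomy i j with h | rfl | h
  · rw [key i j h, if_neg h.ne]
  · simp [hermiteSq]
  · rw [hermiteInner_comm, key j i h, if_neg h.ne']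

/-! ### Uniqueness of monic orthogonal polynomials -/

/-- Each polynomial of degree below `l` is its own Fourier sum in `q_0, …, q_{l-1}`. Applied to `X^l
- q_l`, this is the Gram–Schmidt correction, because `q_l` is orthogonal to the earlier `q_k`.
Linearity is a hypothesis so that both weights are covered. -/
theorem monicOrthoPoly_eq {s : Set ℝ} {w : ℝ → ℝ}
    (hadd : ∀ f g r, weightedInner s w (f + g) r = weightedInner s w f r + weightedInner s w g r)
    (hmul : ∀ a f r, weightedInner s w (C a * f) r = a * weightedInner s w f r)
    {q : ℕ → ℝ[X]} (hq : ∀ l, (q l).Monic ∧ (q l).natDegree = l)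
    (hort : ∀ (l : ℕ) (f : ℝ[X]), f.degree < l → weightedInner s w f (q l) = 0)
    (hpos : ∀ l, weightedInner s w (q l) (q l) ≠ 0) (l : ℕ) : monicOrthoPoly s w l = q l := by
  have hdeg : ∀ l, (q l).degree = (l : ℕ) := fun l => by
    rw [degree_eq_natDegree (hq l).1.ne_zero, (hq l).2]
  have expand_in : ∀ (l : ℕ) (f : ℝ[X]), f.degree < (l : ℕ) →
      f = ∑ k ∈ Finset.range l,
        C (weightedInner s w f (q k) / weightedInner s w (q k) (q k)) * q k := by
    intro l
    induction l with
    | zero =>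
      intro f hf
      simpa using degree_eq_bot.1 (Nat.WithBot.lt_zero_iff.1 hf)
    | succ l ih =>
      intro f hf
      set a := f.coeff l
      have hg : (f - C a * q l).degree < (l : ℕ) := by
        rw [degree_lt_iff_coeff_zero] at hf ⊢
        intro k hk
        rw [coeff_sub, coeff_C_mul]
        rcases hk.eq_or_lt with rfl | hlt
        · have := (hq l).1.coeff_natDegree
          rw [(hq l).2] at this
          simp [a, this]
        · rw [hf k hlt, coeff_eq_zero_of_natDegree_lt (by rw [(hq l).2]; exact hlt)]
          simp
      set g := f - C a * q l with hgdef
      have hf' : f = g + C a * q l := by rw [hgdef]; ring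
      have hin : ∀ k, weightedInner s w f (q k) =
          weightedInner s w g (q k) + a * weightedInner s w (q l) (q k) := by
        intro k; rw [hf', hadd, hmul]
      rw [Finset.sum_range_succ, hin l, hort l g hg, zero_add, mul_div_cancel_right₀ _ (hpos l)]
      conv_lhs => rw [hf', ih g hg]
      congr 1
      refine Finset.sum_congr rfl fun k hk => ?_
      rw [hin k, weightedInner_comm s w (q l), hort l (q k), mul_zero, add_zero]
      rw [hdeg]; exact_mod_cast Finset.mem_range.1 hk
  induction l using Nat.strong_induction_on with
  | _ l ih =>
    rw [monicOrthoPoly, Fin.sum_univ_eq_sum_range (fun k =>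
      C (weightedInner s w (X ^ l) (monicOrthoPoly s w k) /
        weightedInner s w (monicOrthoPoly s w k) (monicOrthoPoly s w k)) * monicOrthoPoly s w k) l]
    have hlt : (X ^ l - q l).degree < (l : WithBot ℕ) := by
      rw [← degree_X_pow (R := ℝ) l]
      refine degree_sub_lt_left (by rw [degree_X_pow, hdeg]) (monic_X_pow l).ne_zero ?_
      rw [(monic_X_pow l).leadingCoeff, (hq l).1.leadingCoeff]
    have h := expand_in l _ hlt
    have e : ∑ k ∈ Finset.range l, C (weightedInner s w (X ^ l) (monicOrthoPoly s w k) /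
        weightedInner s w (monicOrthoPoly s w k) (monicOrthoPoly s w k)) * monicOrthoPoly s w k =
        ∑ k ∈ Finset.range l, C (weightedInner s w (X ^ l - q l) (q k) /
          weightedInner s w (q k) (q k)) * q k := by
      refine Finset.sum_congr rfl fun k hk => ?_
      have hk := Finset.mem_range.1 hk
      have h0 : weightedInner s w (q l) (q k) = 0 := by
        rw [weightedInner_comm]
        refine hort l _ ?_
        rw [hdeg]; exact_mod_cast hk
      have : X ^ l = (X ^ l - q l) + C 1 * q l := by simp
      rw [ih k hk]
      conv_lhs => rw [this, hadd, hmul, h0]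
      simp
    rw [e, ← h]; ring

/-! ### Orthonormal Hermite polynomials -/

theorem hermitePoly_eq (l : ℕ) : hermitePoly l = C (1 / √(hermiteSq l)) * monicHermite l := by
  have h : ∀ l, monicOrthoPoly Set.univ hermiteWeight l = monicHermite l :=
    monicOrthoPoly_eq hermiteInner_add_left hermiteInner_C_mul_left monicHermite_monic
      hermiteInner_monicHermite_eq_zero fun l => (hermiteSq_pos l).ne'
  rw [hermitePoly, orthonormalPoly, h]; rfl

theorem hermiteInner_hermitePoly (i j : ℕ) :
    hermiteInner (hermitePoly i) (hermitePoly j) = if i = j then 1 else 0 := by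
  rw [hermitePoly_eq, hermitePoly_eq, hermiteInner_C_mul_left, hermiteInner_C_mul_right,
    hermiteInner_monicHermite]
  split_ifs with h
  · subst h
    have := Real.mul_self_sqrt (hermiteSq_pos i).le
    have := Real.sqrt_pos.2 (hermiteSq_pos i)
    field_simp; linarith
  · simp

theorem sqrt_hermiteSq_succ (l : ℕ) : √(hermiteSq (l + 1)) = √((l + 1) / 2) * √(hermiteSq l) := by
  rw [hermiteSq_succ, Real.sqrt_mul (by positivity)]

theorem X_mul_hermitePoly (l : ℕ) : X * hermitePoly (l + 1) =
    C √((l + 2) / 2) * hermitePoly (l + 2) + C √((l + 1) / 2) * hermitePoly l := by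
  rw [hermitePoly_eq, hermitePoly_eq, hermitePoly_eq, mul_left_comm, X_mul_monicHermite, mul_add,
    ← mul_assoc, ← mul_assoc, ← mul_assoc, ← C_mul, ← C_mul, ← C_mul, sqrt_hermiteSq_succ (l + 1),
    sqrt_hermiteSq_succ l]
  have h0 := Real.sqrt_pos.2 (hermiteSq_pos l)
  have h1 : 0 < √(((l : ℝ) + 1) / 2) := Real.sqrt_pos.2 (by positivity)
  have h2 : 0 < √(((l : ℝ) + 2) / 2) := Real.sqrt_pos.2 (by positivity)
  have h3 : √(((l : ℝ) + 1) / 2) ^ 2 = (l + 1) / 2 := Real.sq_sqrt (by positivity)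
  push_cast
  rw [show ((l : ℝ) + 1 + 1) = l + 2 by ring]
  congr 3
  · field_simp
  · set u := √(((l : ℝ) + 1) / 2)
    field_simp
    linarith

theorem X_mul_hermitePoly_zero : X * hermitePoly 0 = C √(1 / 2) * hermitePoly 1 := by
  rw [hermitePoly_eq, hermitePoly_eq, sqrt_hermiteSq_succ, mul_left_comm,
    ← mul_assoc (C √(1 / 2)), ← C_mul]
  have h0 := Real.sqrt_pos.2 (hermiteSq_pos 0)
  have h1 : 0 < √((1 : ℝ) / 2) := Real.sqrt_pos.2 (by positivity)
  simp only [CharP.cast_eq_zero, zero_add, monicHermite, derivative_one, mul_zero, sub_zero]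
  congr 2; field_simp

/-- Putting one factor `x` on each side reduces the matrix of `x²` to the recurrence for `x h_l`.
Index `0` is separate because `h_0` has no lower neighbour. -/
theorem hermiteInner_X_X (i j : ℕ) :
    hermiteInner (X * hermitePoly i) (X * hermitePoly j) =
      if i = j then (i + 1 / 2 : ℝ) else if j = i + 2 then hermiteOff i else
        if i = j + 2 then hermiteOff j else 0 := by
  have hs : ∀ x : ℝ, 0 ≤ x → √x * √x = x := fun x hx => Real.mul_self_sqrt hx
  have hoff := fun l => (hermiteOff_eq l).symm
  rcases i with _ | i <;> rcases j with _ | j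
  · rw [X_mul_hermitePoly_zero]
    simp only [hermiteInner_C_mul_left, hermiteInner_C_mul_right, hermiteInner_hermitePoly]
    have := hs (1 / 2) (by norm_num)
    simp at this ⊢
    linarith
  · rw [X_mul_hermitePoly_zero, X_mul_hermitePoly]
    simp only [hermiteInner_C_mul_left, hermiteInner_C_mul_right, hermiteInner_hermitePoly,
      hermiteInner_add_right]
    have := hoff 0
    by_cases h : j = 1
    · subst h
      norm_num at this ⊢
      linarith
    · simp [h, Ne.symm h]
  · rw [X_mul_hermitePoly_zero, X_mul_hermitePoly]
    simp only [hermiteInner_C_mul_left, hermiteInner_C_mul_right, hermiteInner_hermitePoly,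
      hermiteInner_add_left]
    have := hoff 0
    by_cases h : i = 1
    · subst h
      norm_num at this ⊢
      linarith
    · simp [h]
  · rw [X_mul_hermitePoly, X_mul_hermitePoly]
    simp only [hermiteInner_C_mul_left, hermiteInner_C_mul_right, hermiteInner_hermitePoly,
      hermiteInner_add_left, hermiteInner_add_right]
    have h1 := hoff (i + 1)
    have h2 := hoff (j + 1)
    have h3 := hs ((i + 2) / 2) (by positivity)
    have h4 := hs ((i + 1) / 2) (by positivity)
    push_cast at h1 h2 ⊢
    rw [show (i : ℝ) + 1 + 1 = i + 2 by ring] at h1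
    rw [show (j : ℝ) + 1 + 1 = j + 2 by ring] at h2
    rcases eq_or_ne i j with rfl | hij
    · split_ifs <;> first | (exfalso; omega) | linarith
    · by_cases hj : j = i + 2
      · subst hj
        push_cast
        rw [show (i : ℝ) + 2 + 1 = i + 1 + 2 by ring]
        split_ifs <;> first | (exfalso; omega) | linarith
      · by_cases hi : i = j + 2
        · subst hi
          push_cast
          rw [show (j : ℝ) + 2 + 1 = j + 1 + 2 by ring]
          split_ifs <;> first | (exfalso; omega) | linarith
        · split_ifs <;> first | (exfalso; omega) | linarith

/-! ### Laguerre polynomials for `α = -1/2` -/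

/-- The Laguerre inner product for `α = -1/2`. -/
noncomputable abbrev laguerreInner (f g : ℝ[X]) : ℝ :=
  weightedInner (Set.Ici 0) (laguerreWeight (-1 / 2)) f g

/-- Substitute `x = y²`: the Jacobian `2y` cancels the factor `y⁻¹` of the weight, and evenness
turns twice the half-line integral into the integral over `ℝ`. -/
theorem laguerreInner_eq (f g : ℝ[X]) :
    laguerreInner f g = hermiteInner (expand ℝ 2 f) (expand ℝ 2 g) := by
  rw [hermiteInner_eq, laguerreInner, weightedInner, MeasureTheory.integral_Ici_eq_integral_Ioi,
    ← MeasureTheory.integral_comp_rpow_Ioi_of_pos two_pos]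
  have h := integral_comp_abs (f := fun x => eval x (expand ℝ 2 f) * eval x (expand ℝ 2 g) *
    hermiteWeight x)
  have e : ∀ x : ℝ, eval |x| (expand ℝ 2 f) * eval |x| (expand ℝ 2 g) * hermiteWeight |x| =
      eval x (expand ℝ 2 f) * eval x (expand ℝ 2 g) * hermiteWeight x := by
    intro x; simp [expand_eval, hermiteWeight]
  simp only [e] at h
  rw [h, ← MeasureTheory.integral_const_mul]
  refine MeasureTheory.setIntegral_congr_fun measurableSet_Ioi fun x hx => ?_
  have hx : 0 < x := hx
  have h1 : x ^ (2 : ℝ) = x ^ 2 := by norm_cast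
  have h2 : (x ^ 2) ^ (-1 / 2 : ℝ) = x⁻¹ := by
    rw [← h1, ← Real.rpow_mul hx.le]; norm_num [Real.rpow_neg_one]
  simp only [h1, laguerreWeight, h2, expand_eval, hermiteWeight, smul_eq_mul]
  norm_num
  field_simp

/-- The monic Laguerre polynomials for `α = -1/2`. -/
noncomputable def monicLaguerre : ℕ → ℝ[X]
  | 0 => 1
  | 1 => X - C (1 / 2)
  | l + 2 => (X - C (2 * (l + 1) + 1 / 2 : ℝ)) * monicLaguerre (l + 1) -
      C ((l + 1) * (l + 1 / 2) : ℝ) * monicLaguerre l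

theorem X_sq_mul_monicHermite (l : ℕ) : X ^ 2 * monicHermite (l + 2) =
    monicHermite (l + 4) + C (l + 5 / 2 : ℝ) * monicHermite (l + 2) +
      C ((l + 2) * (l + 1) / 4 : ℝ) * monicHermite l := by
  rw [sq, mul_assoc, X_mul_monicHermite (l + 1), mul_add, mul_left_comm, X_mul_monicHermite l,
    X_mul_monicHermite (l + 2), mul_add, ← mul_assoc, ← C_mul]
  have e : C (l + 5 / 2 : ℝ) = C (((l + 2 : ℕ) + 1) / 2 : ℝ) + C (((l + 1 : ℕ) + 1) / 2 : ℝ) := by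
    rw [← C_add]; congr 1; push_cast; ring
  have e2 : C ((l + 2) * (l + 1) / 4 : ℝ) = C ((((l + 1 : ℕ) : ℝ) + 1) / 2 * ((l + 1) / 2)) := by
    congr 1; push_cast; ring
  rw [e, e2]; ring

theorem X_sq_mul_monicHermite_zero : X ^ 2 * monicHermite 0 =
    monicHermite 2 + C (1 / 2) * monicHermite 0 := by
  have h := X_mul_monicHermite 0
  have h0 : monicHermite 1 = X * monicHermite 0 := by simp [monicHermite]
  rw [h0] at h
  rw [sq, mul_assoc, h]; simp

/-- The coefficients of `monicLaguerre` are those of `X_sq_mul_monicHermite` at the even index `2 *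
l`. -/
theorem expand_monicLaguerre (l : ℕ) : expand ℝ 2 (monicLaguerre l) = monicHermite (2 * l) := by
  induction l using Nat.twoStepInduction with
  | zero => simp [monicLaguerre, monicHermite]
  | one =>
    have h := X_sq_mul_monicHermite_zero
    have h0 : monicHermite 0 = 1 := rfl
    rw [h0, mul_one, mul_one] at h
    simp [monicLaguerre, h]
  | more l ih0 ih1 =>
    have h := X_sq_mul_monicHermite (2 * l)
    rw [monicLaguerre, map_sub, map_mul, map_mul, map_sub, ih0, ih1, expand_X, expand_C, expand_C,
      show 2 * (l + 2) = 2 * l + 4 by ring, show 2 * (l + 1) = 2 * l + 2 by ring, sub_mul, h]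
    have e : C ((2 * l : ℕ) + 5 / 2 : ℝ) = C (2 * (l + 1) + 1 / 2 : ℝ) := by
      congr 1; push_cast; ring
    have e2 : C (((2 * l : ℕ) + 2) * ((2 * l : ℕ) + 1) / 4 : ℝ) = C ((l + 1) * (l + 1 / 2) : ℝ) := by
      congr 1; push_cast; ring
    rw [e, e2]; ring

theorem monicLaguerre_monic (l : ℕ) :
    (monicLaguerre l).Monic ∧ (monicLaguerre l).natDegree = l := by
  have h := monicHermite_monic (2 * l)
  rw [← expand_monicLaguerre, monic_expand_iff two_pos, natDegree_expand] at h
  exact ⟨h.1, by omega⟩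

theorem laguerreInner_monicLaguerre_eq_zero (l : ℕ) (f : ℝ[X]) (hf : f.degree < l) :
    laguerreInner f (monicLaguerre l) = 0 := by
  rw [laguerreInner_eq, expand_monicLaguerre]
  refine hermiteInner_monicHermite_eq_zero _ _ ?_
  rcases eq_or_ne f 0 with rfl | h0
  · rw [map_zero, degree_zero]; exact WithBot.bot_lt_coe _
  · have h1 : expand ℝ 2 f ≠ 0 := (expand_ne_zero two_pos).2 h0
    rw [degree_eq_natDegree h0] at hf
    rw [degree_eq_natDegree h1, natDegree_expand]
    have : f.natDegree < l := by exact_mod_cast hf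
    have : f.natDegree * 2 < 2 * l := by omega
    exact_mod_cast this

theorem laguerreInner_add_left (f g r : ℝ[X]) :
    laguerreInner (f + g) r = laguerreInner f r + laguerreInner g r := by
  simp only [laguerreInner_eq, map_add, hermiteInner_add_left]

theorem laguerreInner_C_mul_left (a : ℝ) (f r : ℝ[X]) :
    laguerreInner (C a * f) r = a * laguerreInner f r := by
  simp only [laguerreInner_eq, map_mul, expand_C, hermiteInner_C_mul_left]

theorem laguerrePoly_eq (l : ℕ) :
    laguerrePoly (-1 / 2) l = C (1 / √(hermiteSq (2 * l))) * monicLaguerre l := by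
  have hsq : ∀ l, laguerreInner (monicLaguerre l) (monicLaguerre l) = hermiteSq (2 * l) := by
    intro l; rw [laguerreInner_eq, expand_monicLaguerre]; rfl
  have h : ∀ l, monicOrthoPoly (Set.Ici 0) (laguerreWeight (-1 / 2)) l = monicLaguerre l :=
    monicOrthoPoly_eq laguerreInner_add_left laguerreInner_C_mul_left monicLaguerre_monic
      laguerreInner_monicLaguerre_eq_zero fun l => by
        have := hsq l
        rw [laguerreInner] at this
        rw [this]; exact (hermiteSq_pos _).ne'
  rw [laguerrePoly, orthonormalPoly, h, ← hsq]

/-- `p_l^{(-1/2)}(x²) = h_{2l}(x)`. -/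
theorem expand_laguerrePoly (l : ℕ) : expand ℝ 2 (laguerrePoly (-1 / 2) l) = hermitePoly (2 * l) := by
  rw [laguerrePoly_eq, map_mul, expand_C, expand_monicLaguerre, hermitePoly_eq]

theorem laguerreInner_X_mul_laguerrePoly (i j : ℕ) :
    laguerreInner (X * laguerrePoly (-1 / 2) i) (laguerrePoly (-1 / 2) j) =
      hermiteInner (X * hermitePoly (2 * i)) (X * hermitePoly (2 * j)) := by
  rw [laguerreInner_eq, map_mul, expand_laguerrePoly, expand_laguerrePoly, expand_X, sq, mul_assoc,
    hermiteInner_X_mul]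

theorem recurrenceA_laguerre (l : ℕ) :
    recurrenceA (Set.Ici 0) (laguerreWeight (-1 / 2)) l = (2 * l : ℕ) + 1 / 2 := by
  have h := laguerreInner_X_mul_laguerrePoly l l
  rw [hermiteInner_X_X, if_pos rfl] at h
  exact h

theorem recurrenceB_laguerre (l : ℕ) :
    recurrenceB (Set.Ici 0) (laguerreWeight (-1 / 2)) (l + 1) = hermiteOff (2 * l) := by
  have h := laguerreInner_X_mul_laguerrePoly l (l + 1)
  rw [hermiteInner_X_X, if_neg (by omega), if_pos (by ring)] at h
  exact h

/-! ### Associated polynomials as Jacobi sequences. -/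

theorem associatedPoly_isJacobiSeq (s : Set ℝ) (w : ℝ → ℝ) (k : ℕ)
    (hb : ∀ l, recurrenceB s w (k + l + 1) ≠ 0) :
    IsJacobiSeq (fun j => recurrenceA s w (k + j)) (fun j => recurrenceB s w (k + j + 1))
      (associatedPoly s w k) where
  zero := by rw [associatedPoly]
  one := by
    have := hb 0
    rw [associatedPoly, associatedPoly, ← mul_assoc, ← C_mul, mul_one]
    simp only [add_zero] at this ⊢
    rw [mul_one_div_cancel this, C_1, one_mul]
  succ l := by
    have := hb (l + 1)
    rw [associatedPoly, ← mul_assoc, ← C_mul]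
    rw [mul_one_div_cancel this, C_1, one_mul]
    rfl

theorem associatedLaguerrePoly_isJacobiSeq (k : ℕ) :
    IsJacobiSeq (fun j => ((2 * k + 2 * j : ℕ) : ℝ) + 1 / 2) (fun j => hermiteOff (2 * k + 2 * j))
      (associatedLaguerrePoly (-1 / 2) k) := by
  have h := associatedPoly_isJacobiSeq (Set.Ici 0) (laguerreWeight (-1 / 2)) k fun l => by
    rw [recurrenceB_laguerre]; exact (hermiteOff_pos _).ne'
  simp only [recurrenceA_laguerre, recurrenceB_laguerre, mul_add] at h
  exact h

theorem IsJacobiSeq.unique {a b : ℕ → ℝ} {p q : ℕ → ℝ[X]} (hp : IsJacobiSeq a b p)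
    (hq : IsJacobiSeq a b q) (hb : ∀ l, b l ≠ 0) (l : ℕ) : p l = q l := by
  have hC : ∀ l, C (b l) ≠ 0 := fun l => by simpa using hb l
  induction l using Nat.twoStepInduction with
  | zero => rw [hp.zero, hq.zero]
  | one => exact mul_left_cancel₀ (hC 0) (by rw [hp.one, hq.one, hp.zero, hq.zero])
  | more l h0 h1 => exact mul_left_cancel₀ (hC (l + 1)) (by rw [hp.succ, hq.succ, h0, h1])

theorem sqrt_hermiteSq_add_two (l : ℕ) :
    √(hermiteSq (l + 2)) = hermiteOff l * √(hermiteSq l) := by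
  rw [sqrt_hermiteSq_succ, sqrt_hermiteSq_succ, hermiteOff_eq]
  push_cast
  rw [show (l : ℝ) + 1 + 1 = l + 2 by ring]; ring

/-- Both sides solve the same recurrence, but `p_0(x, 0) = 1` whereas the orthonormal `p_0` is the
constant `1 / √(hermiteSq 0)`. -/
theorem laguerrePoly_eq_associated (l : ℕ) : laguerrePoly (-1 / 2) l =
    C (1 / √(hermiteSq 0)) * associatedLaguerrePoly (-1 / 2) 0 l := by
  have hs : ∀ l, √(hermiteSq l) ≠ 0 := fun l => (Real.sqrt_pos.2 (hermiteSq_pos l)).ne'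
  have hj : IsJacobiSeq (fun j => ((2 * 0 + 2 * j : ℕ) : ℝ) + 1 / 2)
      (fun j => hermiteOff (2 * 0 + 2 * j))
      (fun l => C (√(hermiteSq 0) / √(hermiteSq (2 * l))) * monicLaguerre l) := by
    refine ⟨?_, ?_, fun l => ?_⟩
    · simp [monicLaguerre, hs]
    · simp only [monicLaguerre, mul_zero, mul_one, add_zero]
      rw [← mul_assoc, ← C_mul, show (2 : ℕ) = 0 + 2 from rfl, sqrt_hermiteSq_add_two]
      have h0 := (hermiteOff_pos 0).ne'
      have := hs 0
      rw [show hermiteOff 0 * (√(hermiteSq 0) / (hermiteOff 0 * √(hermiteSq 0))) = 1 by field_simp,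
        show √(hermiteSq 0) / √(hermiteSq 0) = 1 by field_simp]
      simp
    · have h0 := (hermiteOff_pos (2 * l)).ne'
      have h1 := (hermiteOff_pos (2 * l + 2)).ne'
      have h2 := hs 0
      have h3 := hs (2 * l)
      have e0 : 2 * (l + 1) = 2 * l + 2 := by ring
      have e1 : 2 * (l + 2) = 2 * l + 2 + 2 := by ring
      have esq : hermiteOff (2 * l) ^ 2 = (l + 1) * (l + 1 / 2) := by
        rw [hermiteOff, div_pow, Real.sq_sqrt (by positivity)]; push_cast; ring
      simp only [zero_add, mul_zero, e0, e1]
      rw [sqrt_hermiteSq_add_two (2 * l + 2), sqrt_hermiteSq_add_two (2 * l), monicLaguerre,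
        ← mul_assoc, ← mul_assoc (C (hermiteOff (2 * l))), ← C_mul, ← C_mul, ← esq]
      set t := hermiteOff (2 * l)
      set t' := hermiteOff (2 * l + 2)
      set r := √(hermiteSq (2 * l))
      have e2 : t' * (√(hermiteSq 0) / (t' * (t * r))) = √(hermiteSq 0) / (t * r) := by field_simp
      have e3 : t * (√(hermiteSq 0) / r) = √(hermiteSq 0) / (t * r) * t ^ 2 := by field_simp
      rw [e2, e3, C_mul (b := t ^ 2),
        show (((2 * l + 2 : ℕ) : ℝ) + 1 / 2) = 2 * (l + 1) + 1 / 2 by push_cast; ring]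
      ring
  have h := hj.unique (associatedLaguerrePoly_isJacobiSeq 0) (fun l => (hermiteOff_pos _).ne') l
  rw [laguerrePoly_eq, ← h, ← mul_assoc, ← C_mul]
  congr 2
  have := hs 0
  field_simp

/-! ### Hermite expansions over indices of one parity -/

/-- `∑_{j ≤ N} c_j h_{m+2j}` with real coefficients. -/
noncomputable def hermiteSum (m N : ℕ) (c : ℕ → ℝ) : ℝ[X] :=
  ∑ j ∈ Finset.range (N + 1), C (c j) * hermitePoly (m + 2 * j)

/-- `∑_{j ≤ N} c_j h_{m+2j}` with complex coefficients. -/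
noncomputable def hermiteSumC (m N : ℕ) (c : ℕ → ℂ) : ℂ[X] :=
  ∑ j ∈ Finset.range (N + 1), c j • hermitePolyC (m + 2 * j)

theorem hermiteSum_succ (m N : ℕ) (c : ℕ → ℝ) : hermiteSum m (N + 1) c =
    hermiteSum m N c + C (c (N + 1)) * hermitePoly (m + 2 * (N + 1)) :=
  Finset.sum_range_succ _ _

theorem hermiteInner_sum_left (N : ℕ) (f : ℕ → ℝ[X]) (g : ℝ[X]) :
    hermiteInner (∑ j ∈ Finset.range N, f j) g = ∑ j ∈ Finset.range N, hermiteInner (f j) g := by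
  induction N with
  | zero => simp [hermiteInner_zero_left]
  | succ N ih => rw [Finset.sum_range_succ, hermiteInner_add_left, ih, Finset.sum_range_succ]

theorem hermiteInner_hermiteSum_left (m N : ℕ) (c : ℕ → ℝ) (g : ℝ[X]) :
    hermiteInner (hermiteSum m N c) g =
      ∑ j ∈ Finset.range (N + 1), c j * hermiteInner (hermitePoly (m + 2 * j)) g := by
  rw [hermiteSum, hermiteInner_sum_left]
  simp only [hermiteInner_C_mul_left]

theorem hermiteInner_X_hermiteSum_left (m N : ℕ) (c : ℕ → ℝ) (g : ℝ[X]) :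
    hermiteInner (X * hermiteSum m N c) g =
      ∑ j ∈ Finset.range (N + 1), c j * hermiteInner (X * hermitePoly (m + 2 * j)) g := by
  rw [hermiteInner_X_mul, hermiteInner_hermiteSum_left]
  simp only [hermiteInner_X_mul]

theorem hermiteInner_hermiteSum_self (m N : ℕ) (c : ℕ → ℝ) :
    hermiteInner (hermiteSum m N c) (hermiteSum m N c) = ∑ j ∈ Finset.range (N + 1), c j ^ 2 := by
  rw [hermiteInner_hermiteSum_left]
  refine Finset.sum_congr rfl fun j hj => ?_
  rw [hermiteInner_comm, hermiteInner_hermiteSum_left, Finset.sum_eq_single_of_mem j hj]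
  · rw [hermiteInner_hermitePoly, if_pos rfl]; ring
  · intro i _ hij
    rw [hermiteInner_hermitePoly, if_neg (by omega), mul_zero]

theorem hermiteInner_X_hermiteSum_self (m N : ℕ) (c : ℕ → ℝ) :
    hermiteInner (X * hermiteSum m N c) (X * hermiteSum m N c) = hermiteForm m N c := by
  induction N with
  | zero =>
    simp only [hermiteSum, hermiteForm, jacobiForm, zero_add, Finset.sum_range_one,
      Finset.range_zero, Finset.sum_empty, mul_zero, add_zero]
    rw [mul_left_comm, hermiteInner_C_mul_left, hermiteInner_C_mul_right, hermiteInner_X_X,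
      if_pos rfl]
    ring
  | succ N ih =>
    have hcross : hermiteInner (X * hermiteSum m N c) (X * hermitePoly (m + 2 * (N + 1))) =
        c N * hermiteOff (m + 2 * N) := by
      rw [hermiteInner_X_hermiteSum_left,
        Finset.sum_eq_single_of_mem N (Finset.mem_range.2 (Nat.lt_succ_self N))]
      · rw [hermiteInner_X_X, if_neg (by omega), if_pos (by ring)]
      · intro i hi hne
        rw [Finset.mem_range] at hi
        rw [hermiteInner_X_X, if_neg (by omega), if_neg (by omega), if_neg (by omega), mul_zero]
    have hform : hermiteForm m (N + 1) c = hermiteForm m N c +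
        (((m + 2 * (N + 1) : ℕ) : ℝ) + 1 / 2) * c (N + 1) ^ 2 +
        2 * (hermiteOff (m + 2 * N) * c N * c (N + 1)) := by
      unfold hermiteForm jacobiForm
      rw [Finset.sum_range_succ _ (N + 1),
        Finset.sum_range_succ (fun j => hermiteOff (m + 2 * j) * c j * c (j + 1)) N]
      ring
    rw [hermiteSum_succ, mul_add, mul_left_comm]
    simp only [hermiteInner_add_left, hermiteInner_add_right, hermiteInner_C_mul_left,
      hermiteInner_C_mul_right]
    rw [hermiteInner_comm (X * hermitePoly _) (X * hermiteSum m N c), hcross, ih, hform,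
      hermiteInner_X_X, if_pos rfl]
    ring

theorem hermiteInner_hermiteSum_succ (m N : ℕ) (c d : ℕ → ℝ) :
    hermiteInner (hermiteSum m N c) (hermiteSum (m + 1) N d) = 0 := by
  rw [hermiteInner_hermiteSum_left]
  refine Finset.sum_eq_zero fun j _ => ?_
  rw [hermiteInner_comm, hermiteInner_hermiteSum_left, Finset.sum_eq_zero, mul_zero]
  intro i _
  rw [hermiteInner_hermitePoly, if_neg (by omega), mul_zero]

theorem hermiteInner_X_hermiteSum_succ (m N : ℕ) (c d : ℕ → ℝ) :
    hermiteInner (X * hermiteSum m N c) (X * hermiteSum (m + 1) N d) = 0 := by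
  rw [hermiteInner_X_hermiteSum_left]
  refine Finset.sum_eq_zero fun j _ => ?_
  rw [hermiteInner_comm, hermiteInner_X_hermiteSum_left, Finset.sum_eq_zero, mul_zero]
  intro i _
  rw [hermiteInner_X_X, if_neg (by omega), if_neg (by omega), if_neg (by omega), mul_zero]

/-- The real form of the variational problem: with equality only for multiples of the ground state
on the indices of the parity of `m`. -/
theorem hermiteInner_X_ge {m N : ℕ} {p : ℕ → ℝ[X]} {z : ℝ}
    (hp : IsJacobiSeq (fun j => (m + 2 * j : ℕ) + 1 / 2) (fun j => hermiteOff (m + 2 * j)) p)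
    (hz : (p (N + 1)).eval z = 0) (halt : ∀ j ≤ N, 0 < (-1) ^ j * (p j).eval z)
    (e o : ℕ → ℝ) (ho : o N = 0) {U : ℝ[X]} (hU : U = hermiteSum m N e + hermiteSum (m + 1) N o) :
    z * hermiteInner U U ≤ hermiteInner (X * U) (X * U) ∧
    (hermiteInner (X * U) (X * U) = z * hermiteInner U U →
      ∃ r : ℝ, U = C r * hermiteSum m N fun j => (p j).eval z) := by
  have h1 := hp.jacobiForm_ge (fun l => hermiteOff_pos _) hz halt e
  -- The bound for the right parity is applied to the coefficients of the opposite parity too; `h3`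
  -- transfers it to their own form.
  have h2 := hp.jacobiForm_ge (fun l => hermiteOff_pos _) hz halt o
  have h3 := hermiteForm_le_succ m N o
  have hUU : hermiteInner U U = ∑ j ∈ Finset.range (N + 1), e j ^ 2 +
      ∑ j ∈ Finset.range (N + 1), o j ^ 2 := by
    rw [hU]
    simp only [hermiteInner_add_left, hermiteInner_add_right]
    rw [hermiteInner_comm (hermiteSum (m + 1) N o) (hermiteSum m N e), hermiteInner_hermiteSum_succ,
      hermiteInner_hermiteSum_self, hermiteInner_hermiteSum_self]
    ring
  have hXU : hermiteInner (X * U) (X * U) = hermiteForm m N e + hermiteForm (m + 1) N o := by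
    rw [hU, mul_add]
    simp only [hermiteInner_add_left, hermiteInner_add_right]
    rw [hermiteInner_comm (X * hermiteSum (m + 1) N o) (X * hermiteSum m N e),
      hermiteInner_X_hermiteSum_succ, hermiteInner_X_hermiteSum_self,
      hermiteInner_X_hermiteSum_self]
    ring
  rw [hUU, hXU]
  change _ ≤ hermiteForm m N e ∧ (hermiteForm m N e = _ ↔ _) at h1
  change _ ≤ hermiteForm m N o ∧ (hermiteForm m N o = _ ↔ _) at h2
  refine ⟨by linarith [h1.1, h2.1], fun heq => ?_⟩
  obtain ⟨r, hr⟩ := h1.2.1 (by linarith [h1.1, h2.1])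
  obtain ⟨t, ht⟩ := h2.2.1 (by linarith [h1.1, h2.1])
  have hN := halt N le_rfl
  -- The padding entry `o N` is zero while `p_N(z)` is not, so the multiple must be trivial.
  have ht0 : t = 0 := by
    have := ht N le_rfl
    rw [ho, eq_comm, mul_eq_zero] at this
    refine this.resolve_right fun h0 => ?_
    simp [h0] at hN
  refine ⟨r, ?_⟩
  have ho0 : hermiteSum (m + 1) N o = 0 := by
    refine Finset.sum_eq_zero fun j hj => ?_
    rw [ht j (Finset.mem_range_succ_iff.1 hj), ht0]; simp
  rw [hU, ho0, add_zero, hermiteSum, hermiteSum, Finset.mul_sum]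
  refine Finset.sum_congr rfl fun j hj => ?_
  rw [hr j (Finset.mem_range_succ_iff.1 hj), C_mul, mul_assoc]

/-! ### Complex polynomials -/

/-- The complex polynomial with real part `U` and imaginary part `V`. -/
noncomputable def complexPoly (U V : ℝ[X]) : ℂ[X] :=
  U.map (algebraMap ℝ ℂ) + C Complex.I * V.map (algebraMap ℝ ℂ)

theorem norm_eval_complexPoly_sq (U V : ℝ[X]) (x : ℝ) :
    ‖(complexPoly U V).eval (x : ℂ)‖ ^ 2 = U.eval x * U.eval x + V.eval x * V.eval x := by
  have e : ∀ W : ℝ[X], (W.map (algebraMap ℝ ℂ)).eval (x : ℂ) = ((W.eval x : ℝ) : ℂ) := fun W => by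
    have := eval_map_apply (algebraMap ℝ ℂ) (p := W) x
    simpa using this
  rw [complexPoly, eval_add, eval_mul, eval_C, e, e, Complex.sq_norm, Complex.normSq_apply]
  simp

theorem hermiteNorm_complexPoly (U V : ℝ[X]) :
    hermiteNorm (complexPoly U V) ^ 2 = hermiteInner U U + hermiteInner V V := by
  rw [hermiteNorm, Real.sq_sqrt, hermiteInner_eq, hermiteInner_eq,
    ← MeasureTheory.integral_add (integrable_eval_mul_eval U U) (integrable_eval_mul_eval V V)]
  · simp only [norm_eval_complexPoly_sq, add_mul]
  · refine MeasureTheory.integral_nonneg fun x => ?_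
    simp only [hermiteWeight, Pi.zero_apply]
    positivity

theorem positionVar_complexPoly (U V : ℝ[X]) :
    positionVar (complexPoly U V) =
      hermiteInner (X * U) (X * U) + hermiteInner (X * V) (X * V) := by
  rw [positionVar, hermiteInner_eq, hermiteInner_eq, ← MeasureTheory.integral_add
    (integrable_eval_mul_eval _ _) (integrable_eval_mul_eval _ _)]
  congr 1; ext x
  rw [norm_eval_complexPoly_sq]
  simp only [eval_mul, eval_X]
  ring

theorem hermiteNorm_smul (c : ℂ) (P : ℂ[X]) : hermiteNorm (c • P) = ‖c‖ * hermiteNorm P := by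
  have e : ∀ x : ℝ, ‖(c • P).eval (x : ℂ)‖ ^ 2 * hermiteWeight x =
      ‖c‖ ^ 2 * (‖P.eval (x : ℂ)‖ ^ 2 * hermiteWeight x) := by
    intro x; rw [eval_smul, norm_smul]; ring
  simp only [hermiteNorm, e]
  rw [MeasureTheory.integral_const_mul, Real.sqrt_mul (by positivity),
    Real.sqrt_sq (norm_nonneg c)]

theorem positionVar_smul (c : ℂ) (P : ℂ[X]) :
    positionVar (c • P) = ‖c‖ ^ 2 * positionVar P := by
  have e : ∀ x : ℝ, x ^ 2 * ‖(c • P).eval (x : ℂ)‖ ^ 2 * hermiteWeight x =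
      ‖c‖ ^ 2 * (x ^ 2 * ‖P.eval (x : ℂ)‖ ^ 2 * hermiteWeight x) := by
    intro x; rw [eval_smul, norm_smul]; ring
  simp only [positionVar, e]
  exact MeasureTheory.integral_const_mul _ _

theorem hermiteSumC_eq (m N : ℕ) (c : ℕ → ℂ) : hermiteSumC m N c =
    complexPoly (hermiteSum m N fun j => (c j).re) (hermiteSum m N fun j => (c j).im) := by
  rw [complexPoly, hermiteSumC, hermiteSum, hermiteSum, Polynomial.map_sum, Polynomial.map_sum,
    Finset.mul_sum, ← Finset.sum_add_distrib]
  refine Finset.sum_congr rfl fun j _ => ?_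
  rw [Polynomial.map_mul, Polynomial.map_mul, map_C, map_C, smul_eq_C_mul, ← mul_assoc, ← C_mul,
    ← add_mul, ← C_add, hermitePolyC]
  congr 2
  simp [mul_comm Complex.I, Complex.re_add_im]

theorem complexPoly_add (U V U' V' : ℝ[X]) :
    complexPoly (U + U') (V + V') = complexPoly U V + complexPoly U' V' := by
  simp only [complexPoly, Polynomial.map_add]; ring

theorem complexPoly_C_mul (r t : ℝ) (U : ℝ[X]) :
    complexPoly (C r * U) (C t * U) = ((r : ℂ) + t * Complex.I) • complexPoly U 0 := by
  simp only [complexPoly, Polynomial.map_mul, map_C, smul_eq_C_mul, C_add, C_mul,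
    Complex.coe_algebraMap, Polynomial.map_zero]
  ring

theorem hermiteSumC_ofReal (m N : ℕ) (c : ℕ → ℝ) :
    hermiteSumC m N (fun j => (c j : ℂ)) = complexPoly (hermiteSum m N c) 0 := by
  rw [hermiteSumC_eq]
  simp [hermiteSum]

/-- The condition `o N = 0` reflects that `h_{m+1+2N}` lies outside the space; padding gives both
families the same length. -/
theorem exists_of_mem_hermiteSpace {m N : ℕ} {P : ℂ[X]} (hP : P ∈ hermiteSpace m (m + 2 * N)) :
    ∃ e o : ℕ → ℂ, o N = 0 ∧ P = hermiteSumC m N e + hermiteSumC (m + 1) N o := by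
  induction hP using Submodule.span_induction with
  | mem P hP =>
    obtain ⟨l, ⟨h1, h2⟩, rfl⟩ := hP
    have single : ∀ s j, j ≤ N → hermiteSumC s N (Pi.single j 1) = hermitePolyC (s + 2 * j) := by
      intro s j hj
      rw [hermiteSumC, Finset.sum_eq_single_of_mem j (Finset.mem_range_succ_iff.2 hj)]
      · simp
      · intro i _ hij
        simp [Pi.single_eq_of_ne hij]
    have zero : ∀ s, hermiteSumC s N 0 = 0 := fun s => by simp [hermiteSumC]
    obtain ⟨j, hj | hj⟩ : ∃ j, l = m + 2 * j ∨ l = m + 1 + 2 * j := ⟨(l - m) / 2, by omega⟩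
    · exact ⟨Pi.single j 1, 0, rfl, by rw [single _ _ (by omega), zero, add_zero, hj]⟩
    · refine ⟨0, Pi.single j 1, Pi.single_eq_of_ne (by omega) _, ?_⟩
      rw [single _ _ (by omega), zero, zero_add, hj]
  | zero => exact ⟨0, 0, rfl, by simp [hermiteSumC]⟩
  | add P Q _ _ hP hQ =>
    obtain ⟨e, o, ho, rfl⟩ := hP
    obtain ⟨e', o', ho', rfl⟩ := hQ
    refine ⟨e + e', o + o', by simp [ho, ho'], ?_⟩
    simp only [hermiteSumC, Pi.add_apply, add_smul, Finset.sum_add_distrib]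
    abel
  | smul c P _ hP =>
    obtain ⟨e, o, ho, rfl⟩ := hP
    refine ⟨c • e, c • o, by simp [ho], ?_⟩
    simp only [hermiteSumC, Pi.smul_apply, smul_add, Finset.smul_sum, smul_smul, smul_eq_mul]

theorem hermiteSumC_mem_hermiteSpace (m N : ℕ) (c : ℕ → ℂ) :
    hermiteSumC m N c ∈ hermiteSpace m (m + 2 * N) := by
  refine Submodule.sum_mem _ fun j hj => Submodule.smul_mem _ _ (Submodule.subset_span ?_)
  rw [Finset.mem_range] at hj
  exact ⟨m + 2 * j, ⟨by omega, by omega⟩, rfl⟩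

/-- On the real line `|U + iV|² = U² + V²`, so the real bound applies to each part, and equality
must hold in both. The two real multiples `r`, `t` combine to the scalar `r + t i`. -/
theorem positionVar_ge {m N : ℕ} {p : ℕ → ℝ[X]} {z : ℝ}
    (hp : IsJacobiSeq (fun j => (m + 2 * j : ℕ) + 1 / 2) (fun j => hermiteOff (m + 2 * j)) p)
    (hz : (p (N + 1)).eval z = 0) (halt : ∀ j ≤ N, 0 < (-1) ^ j * (p j).eval z)
    {P : ℂ[X]} (hP : P ∈ hermiteSpace m (m + 2 * N)) :
    z * hermiteNorm P ^ 2 ≤ positionVar P ∧ (positionVar P = z * hermiteNorm P ^ 2 →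
      ∃ c : ℂ, P = c • hermiteSumC m N fun j => ((p j).eval z : ℝ)) := by
  obtain ⟨e, o, ho, rfl⟩ := exists_of_mem_hermiteSpace hP
  rw [hermiteSumC_eq, hermiteSumC_eq, ← complexPoly_add, hermiteNorm_complexPoly,
    positionVar_complexPoly]
  have h1 := hermiteInner_X_ge hp hz halt (fun j => (e j).re) (fun j => (o j).re)
    (by simp [ho]) rfl
  have h2 := hermiteInner_X_ge hp hz halt (fun j => (e j).im) (fun j => (o j).im)
    (by simp [ho]) rfl
  refine ⟨by linarith [h1.1, h2.1], fun heq => ?_⟩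
  obtain ⟨r, hr⟩ := h1.2 (by linarith [h1.1, h2.1])
  obtain ⟨t, ht⟩ := h2.2 (by linarith [h1.1, h2.1])
  refine ⟨r + t * Complex.I, ?_⟩
  rw [hermiteSumC_ofReal, ← complexPoly_C_mul, hr, ht]

theorem positionVar_groundState {m N : ℕ} {p : ℕ → ℝ[X]} {z : ℝ}
    (hp : IsJacobiSeq (fun j => (m + 2 * j : ℕ) + 1 / 2) (fun j => hermiteOff (m + 2 * j)) p)
    (hz : (p (N + 1)).eval z = 0) (halt : ∀ j ≤ N, 0 < (-1) ^ j * (p j).eval z)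
    {H : ℂ[X]} (hH : H = hermiteSumC m N fun j => ((p j).eval z : ℝ)) :
    0 < hermiteNorm H ∧ positionVar H = z * hermiteNorm H ^ 2 := by
  have h := (hp.jacobiForm_ge (fun l => hermiteOff_pos _) hz halt fun j => (p j).eval z).2.2
    ⟨1, fun j _ => (one_mul _).symm⟩
  change hermiteForm m N _ = _ at h
  have hsq := hermiteNorm_complexPoly (hermiteSum m N fun j => (p j).eval z) 0
  have hvar := positionVar_complexPoly (hermiteSum m N fun j => (p j).eval z) 0
  rw [mul_zero, hermiteInner_zero_left, add_zero] at hvar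
  rw [hermiteInner_zero_left, add_zero] at hsq
  rw [hermiteSumC_ofReal] at hH
  rw [← hH] at hsq hvar
  rw [hermiteInner_X_hermiteSum_self, h, ← hermiteInner_hermiteSum_self m, ← hsq] at hvar
  refine ⟨lt_of_le_of_ne (Real.sqrt_nonneg _) fun h0 => ?_, hvar⟩
  rw [← h0, hermiteInner_hermiteSum_self] at hsq
  -- The norm cannot vanish because the coefficient at `j = 0` is `1`.
  have h1 : (p 0).eval z ^ 2 ≤ ∑ j ∈ Finset.range (N + 1), (p j).eval z ^ 2 :=
    Finset.single_le_sum (f := fun j => (p j).eval z ^ 2) (fun j _ => sq_nonneg _) (by simp)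
  rw [← hsq, hp.zero] at h1
  norm_num at h1

/-! ### Existence, value and uniqueness of the minimizers. -/

/-- The solution of the minimization problem in terms of the associated Laguerre polynomials. -/
theorem exists_minimizer (k N : ℕ) : ∃ lam : ℝ,
    IsSmallestZero (associatedLaguerrePoly (-1 / 2) k (N + 1)) lam ∧
    IsLeast (positionVar '' hermiteSphere (2 * k) (2 * k + 2 * N)) lam ∧
    ∃ (κ : ℂ) (H : ℂ[X]),
      H = κ • ∑ l ∈ Finset.Icc k (k + N),
        (((associatedLaguerrePoly (-1 / 2) k (l - k)).eval lam : ℝ) : ℂ) • hermitePolyC (2 * l) ∧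
      H ∈ hermiteSphere (2 * k) (2 * k + 2 * N) ∧
      positionVarArgmin (hermiteSphere (2 * k) (2 * k + 2 * N)) =
        {P | ∃ c : ℂ, ‖c‖ = 1 ∧ P = c • H} := by
  have hp := associatedLaguerrePoly_isJacobiSeq k
  obtain ⟨lam, hlam, halt⟩ :=
    hp.exists_smallest_zero_alternating (fun l => hermiteOff_pos _) N
  set p := associatedLaguerrePoly (-1 / 2) k
  set v := hermiteSumC (2 * k) N fun j => ((p j).eval lam : ℝ) with hv
  have hsum : ∑ l ∈ Finset.Icc k (k + N),
      (((p (l - k)).eval lam : ℝ) : ℂ) • hermitePolyC (2 * l) = v := by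
    rw [show Finset.Icc k (k + N) = Finset.Ico k (k + N + 1) from rfl,
      Finset.sum_Ico_eq_sum_range, show k + N + 1 - k = N + 1 by omega, hv, hermiteSumC]
    refine Finset.sum_congr rfl fun j _ => ?_
    rw [Nat.add_sub_cancel_left, mul_add]
  obtain ⟨hv0, hvar⟩ := positionVar_groundState hp hlam.1 halt hv
  set S := hermiteSphere (2 * k) (2 * k + 2 * N) with hS
  have hvS : v ∈ hermiteSpace (2 * k) (2 * k + 2 * N) := hermiteSumC_mem_hermiteSpace _ _ _
  have hnorm : ∀ c : ℂ, ‖c‖ * hermiteNorm v = 1 → c • v ∈ S ∧ positionVar (c • v) = lam := by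
    intro c hc
    refine ⟨⟨Submodule.smul_mem _ _ hvS, by rw [hermiteNorm_smul, hc]⟩, ?_⟩
    rw [positionVar_smul, hvar]
    linear_combination lam * (‖c‖ * hermiteNorm v + 1) * hc
  have hκ : ‖((1 / hermiteNorm v : ℝ) : ℂ)‖ * hermiteNorm v = 1 := by
    rw [Complex.norm_real, Real.norm_of_nonneg (by positivity)]; field_simp
  obtain ⟨hHS, hHvar⟩ := hnorm _ hκ
  have hge : ∀ P ∈ S, lam ≤ positionVar P := by
    intro P hP
    have := (positionVar_ge hp hlam.1 halt hP.1).1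
    rwa [hP.2, one_pow, mul_one] at this
  refine ⟨lam, hlam, ⟨⟨_, hHS, hHvar⟩, ?_⟩, ((1 / hermiteNorm v : ℝ) : ℂ),
    ((1 / hermiteNorm v : ℝ) : ℂ) • v, by rw [hsum], hHS, ?_⟩
  · rintro _ ⟨P, hP, rfl⟩
    exact hge P hP
  · ext P
    constructor
    · rintro ⟨hP, hmin⟩
      have heq : positionVar P = lam := le_antisymm (hHvar ▸ hmin hHS) (hge P hP)
      obtain ⟨c, hc⟩ := (positionVar_ge hp hlam.1 halt hP.1).2 (by rw [heq, hP.2]; ring)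
      have hc1 : ‖c‖ * hermiteNorm v = 1 := by rw [← hermiteNorm_smul, ← hc, hP.2]
      -- The reference minimizer is `v / ‖v‖`, so a multiple `c` of `v` is the multiple `c ‖v‖` of
      -- it.
      refine ⟨c * hermiteNorm v, ?_, ?_⟩
      · rw [norm_mul, Complex.norm_real, Real.norm_of_nonneg hv0.le, hc1]
      · rw [smul_smul, hc]
        congr 1
        have : (hermiteNorm v : ℂ) ≠ 0 := by exact_mod_cast hv0.ne'
        push_cast
        field_simp
    · rintro ⟨c, hc, rfl⟩
      have h := hnorm (c * ((1 / hermiteNorm v : ℝ) : ℂ)) (by rw [norm_mul, hc, one_mul, hκ])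
      rw [mul_smul] at h
      refine ⟨h.1, fun Q hQ => ?_⟩
      rw [Set.mem_ofPred_eq, h.2]
      exact hge Q hQ

theorem theorem5p2 (n m : ℕ) (hn : Even n) (hm : Even m) (hmn : m ≤ n) :
    (∃ lam : ℝ,
      IsSmallestZero (laguerrePoly (-1 / 2) (n / 2 + 1)) lam ∧
      IsLeast (positionVar '' hermiteSphere 0 n) lam ∧
      ∃ (κ : ℂ) (H : ℂ[X]),
        H = κ • ∑ l ∈ Finset.Icc 0 (n / 2),
          (((laguerrePoly (-1 / 2) l).eval lam : ℝ) : ℂ) • hermitePolyC (2 * l) ∧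
        H ∈ hermiteSphere 0 n ∧
        positionVarArgmin (hermiteSphere 0 n) = {P | ∃ c : ℂ, ‖c‖ = 1 ∧ P = c • H}) ∧
    (∃ lam : ℝ,
      IsSmallestZero (associatedLaguerrePoly (-1 / 2) (m / 2) ((n - m) / 2 + 1)) lam ∧
      IsLeast (positionVar '' hermiteSphere m n) lam ∧
      ∃ (κ : ℂ) (H : ℂ[X]),
        H = κ • ∑ l ∈ Finset.Icc (m / 2) (n / 2),
          (((associatedLaguerrePoly (-1 / 2) (m / 2) (l - m / 2)).eval lam : ℝ) : ℂ) •
            hermitePolyC (2 * l) ∧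
        H ∈ hermiteSphere m n ∧
        positionVarArgmin (hermiteSphere m n) = {P | ∃ c : ℂ, ‖c‖ = 1 ∧ P = c • H}) := by
  obtain ⟨k, rfl⟩ := even_iff_exists_two_mul.1 hm
  obtain ⟨n', rfl⟩ := even_iff_exists_two_mul.1 hn
  have hk : 2 * k / 2 = k := by omega
  have hn' : 2 * n' / 2 = n' := by omega
  refine ⟨?_, ?_⟩
  · obtain ⟨lam, hlam, hleast, κ, H, hH, hHS, hargmin⟩ := exists_minimizer 0 n'
    rw [mul_zero, zero_add] at hleast hHS hargmin
    have hs : √(hermiteSq 0) ≠ 0 := (Real.sqrt_pos.2 (hermiteSq_pos 0)).ne'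
    have hsC : ((√(hermiteSq 0) : ℝ) : ℂ) ≠ 0 := by exact_mod_cast hs
    -- The orthonormal and the associated polynomials with shift `0` differ by the factor `1 /
    -- √(hermiteSq 0)`: the zeros agree, and `κ` absorbs the factor.
    refine ⟨lam, ?_, hleast, κ * (√(hermiteSq 0) : ℝ), H, ?_, hHS, hargmin⟩
    · have e : {y : ℝ | (laguerrePoly (-1 / 2) (n' + 1)).eval y = 0} =
          {y : ℝ | (associatedLaguerrePoly (-1 / 2) 0 (n' + 1)).eval y = 0} := by
        ext y
        simp [laguerrePoly_eq_associated, hs]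
      rw [hn', IsSmallestZero, e]
      exact hlam
    · rw [hH, hn', mul_smul, zero_add]
      congr 1
      rw [Finset.smul_sum]
      refine Finset.sum_congr rfl fun l _ => ?_
      rw [laguerrePoly_eq_associated, eval_mul, eval_C, smul_smul, Nat.sub_zero]
      congr 1
      push_cast
      field_simp
  · obtain ⟨N, rfl⟩ : ∃ N, n' = k + N := ⟨n' - k, by omega⟩
    rw [hk, hn', show (2 * (k + N) - 2 * k) / 2 = N by omega, mul_add]
    exact exists_minimizer k N
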